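/- Let $n \ge 3$ and let $f_1, \ldots, f_n \in \mathbb{C}[x_1,\ldots,x_l]$ be (possibly multivariate) polynomials, not all constant, such that $f_1 + f_2 + \cdots + f_n = 0$. Assume furthermore that for every $s \ge 1$ and all $1 \le i_1 < i_2 < \cdots < i_s \le n$, $$f_{i_1} + f_{i_2} + \cdots + f_{i_s} = 0 \Longrightarrow \gcd\{f_{i_1}, f_{i_2}, \ldots, f_{i_s}\} = 1.$$ Let $d$ be the dimension of the vector space over $\mathbb{C}$ spanned by $f_1, \ldots, f_n$. For a nonzero polynomial $g$ let $\mathfrak{r}(g)$ denote its square-free part, that is, the product of the pairwise non-associated irreducible factors of $g$, each taken once, and put $r(g) = \deg \mathfrak{r}(g)$ and $r_e(g) = \deg \gcd\{g, \mathfrak{r}(g)^e\}$ for integers $e \ge 1$, where $\deg$ is the total degree. Then there exists an integer $\sigma$ with $1 \le \sigma \le d(d-1)/2$ such that $$\max_{1 \le m \le n} \deg f_m \;\le\; r_\sigma(f_1 f_2 \cdots f_n) - \sigma \;\le\; \frac{d'(d'-1)}{2}\Big(r(f_1 f_2 \cdots f_n) - 1\Big)$$ for all integers $d' \ge d$. 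-/

import Mathlib

/-- The ring `ℂ[x₁, …, x_l]` is a unique factorization domain; we fix a choice of normalized
representatives and of normalized gcds. Different choices change the polynomials below only by
nonzero constant factors. -/
noncomputable instance instStrongNormalizedGCDMonoidMvPolyC (l : ℕ) :
    StrongNormalizedGCDMonoid (MvPolynomial (Fin l) ℂ) :=
  letI : StrongNormalizationMonoid (MvPolynomial (Fin l) ℂ) :=
    UniqueFactorizationMonoid.strongNormalizationMonoid
  UniqueFactorizationMonoid.toStrongNormalizedGCDMonoid (MvPolynomial (Fin l) ℂ)

/-- The square-free part of `g`: the product of the distinct irreducible factors of `g`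
(up to associates). -/
noncomputable def sqfreePart {l : ℕ} (g : MvPolynomial (Fin l) ℂ) : MvPolynomial (Fin l) ℂ :=
  UniqueFactorizationMonoid.radical g

/-- `gcd {g, (square-free part of g) ^ e}`. -/
noncomputable def truncPart {l : ℕ} (e : ℕ) (g : MvPolynomial (Fin l) ℂ) :
    MvPolynomial (Fin l) ℂ :=
  gcd g (sqfreePart g ^ e)

/-- `r(g)`: the degree of the square-free part of `g`. -/
noncomputable def radDeg {l : ℕ} (g : MvPolynomial (Fin l) ℂ) : ℕ :=
  (sqfreePart g).totalDegree

/-- `r_e(g)`: the degree of `gcd {g, (square-free part of g) ^ e}`. -/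
noncomputable def truncRadDeg {l : ℕ} (e : ℕ) (g : MvPolynomial (Fin l) ℂ) : ℕ :=
  (truncPart e g).totalDegree

/-! Fix `m` with `f m` of maximal degree and a vanishing subsum `S` through `m` none of whose proper
nonempty subsums vanish; by hypothesis its terms are coprime. Restricting to a line `x + t a` with
`x` generic turns them into polynomials in `t` over the field of fractions of `ℂ[x]`. For suitable
`a` this keeps the degree of `f m`, raises no other degree and preserves coprimality.

In one variable, starting from `{m}`, the index set is enlarged by blocks `E`, each carrying a
minimal relation modulo the span of what is already present. Any single element of each `E` may be
dropped to leave a basis: at a prime `p` the one of least multiplicity, at infinity the one of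
largest degree. `HeightBound.step` balances these choices by a gcd-lcm degree count. All bases have
the same Wronskian `W` up to a constant, and `W` loses at most `s = 0 + 1 + ... + (|B| - 1)` powers
of each prime and gains `s` at infinity. Comparing degrees gives `deg f m + s ≤ deg Q` for every `Q`
divisible by the prime powers of exponent at most `s` in the product (`exists_natDegree_add_le`).
Taking `Q` to be the image of `truncPart s` of the full product proves the theorem with `σ = s`. -/

open Polynomial in
/-- The Wronskian matrix of a finite family of polynomials. -/
noncomputable def wronskianMatrix {K : Type*} [CommRing K] {d : ℕ} (f : Fin d → K[X]) :
    Matrix (Fin d) (Fin d) K[X] :=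
  Matrix.of fun i j => derivative^[(j : ℕ)] (f i)

/-! ### Wronskians: local divisibility, degree and nonvanishing -/

namespace wronskianMatrix

open Polynomial

variable {K : Type*} {d : ℕ}

theorem det_of_eq_sum [CommRing K] {f g : Fin d → K[X]} (A : Matrix (Fin d) (Fin d) K)
    (h : ∀ i, f i = ∑ k, A i k • g k) :
    (wronskianMatrix f).det = C A.det * (wronskianMatrix g).det := by
  have : wronskianMatrix f = A.map C * wronskianMatrix g := by
    ext1 i j
    simp only [wronskianMatrix, Matrix.of_apply, Matrix.mul_apply, Matrix.map_apply, h,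
      iterate_derivative_sum, iterate_derivative_smul]
    simp only [smul_eq_C_mul]
  rw [this, Matrix.det_mul, RingHom.map_det]
  rfl

theorem pow_dvd_pow_mul_iterate_derivative [CommRing K] {p f : K[X]} {n : ℕ} (j : ℕ)
    (h : p ^ n ∣ f) : p ^ n ∣ p ^ j * derivative^[j] f := by
  refine (pow_dvd_pow p (show n ≤ j + (n - j) by omega)).trans ?_
  rw [pow_add]
  exact mul_dvd_mul_left _ (pow_sub_dvd_iterate_derivative_of_pow_dvd j h)

theorem det_mul_pow [CommRing K] (p : K[X]) (f : Fin d → K[X]) :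
    (Matrix.of fun i j : Fin d => p ^ (j : ℕ) * derivative^[(j : ℕ)] (f i)).det =
      p ^ (∑ j : Fin d, (j : ℕ)) * (wronskianMatrix f).det := by
  rw [← Finset.prod_pow_eq_pow_sum, ← Matrix.det_mul_row]
  rfl

/-- Each derivative costs at most one power of `p`. Scaling column `j` by `p ^ j` pays for this,
after which row `i` is divisible by `p ^ n i`. -/
theorem pow_sum_dvd [CommRing K] {p : K[X]} {f : Fin d → K[X]} {n : Fin d → ℕ}
    (h : ∀ i, p ^ n i ∣ f i) :
    p ^ (∑ i, n i) ∣ p ^ (∑ j : Fin d, (j : ℕ)) * (wronskianMatrix f).det := by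
  choose c hc using fun i (j : Fin d) => pow_dvd_pow_mul_iterate_derivative (j : ℕ) (h i)
  have : (Matrix.of fun i j : Fin d => p ^ (j : ℕ) * derivative^[(j : ℕ)] (f i)) =
      Matrix.of fun i j => p ^ n i * Matrix.of c i j := by
    ext1 i j
    simp [hc]
  rw [← det_mul_pow, this, Matrix.det_mul_column, Finset.prod_pow_eq_pow_sum]
  exact dvd_mul_right _ _

theorem natDegree_X_pow_mul_iterate_derivative_le [CommRing K] (f : K[X]) (j : ℕ) :
    (X ^ j * derivative^[j] f).natDegree ≤ f.natDegree := by
  by_cases h : j ≤ f.natDegree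
  · refine natDegree_mul_le.trans ?_
    have h1 := natDegree_iterate_derivative f j
    have h2 := natDegree_X_pow_le (R := K) j
    omega
  · rw [iterate_derivative_eq_zero (by omega)]
    simp

theorem natDegree_det_le [CommRing K] {M : Matrix (Fin d) (Fin d) K[X]} {n : Fin d → ℕ}
    (h : ∀ i j, (M i j).natDegree ≤ n i) : M.det.natDegree ≤ ∑ i, n i := by
  rw [← Matrix.det_transpose, Matrix.det_apply]
  refine natDegree_sum_le_of_forall_le _ _ fun σ _ => ?_
  refine (natDegree_smul_le _ _).trans ((natDegree_prod_le _ _).trans ?_)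
  exact Finset.sum_le_sum fun i _ => h i _

/-- The counterpart at infinity: the same column scaling with `X` for `p`, since `X ^ j` times the
`j`-th derivative does not raise degrees. -/
theorem natDegree_det_add_le [Field K] {f : Fin d → K[X]} (h : (wronskianMatrix f).det ≠ 0) :
    (wronskianMatrix f).det.natDegree + ∑ j : Fin d, (j : ℕ) ≤ ∑ i, (f i).natDegree := by
  have h1 := natDegree_det_le (M := Matrix.of fun i j : Fin d =>
    X ^ (j : ℕ) * derivative^[(j : ℕ)] (f i)) (n := fun i => (f i).natDegree)
    fun i j => natDegree_X_pow_mul_iterate_derivative_le _ _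
  rw [det_mul_pow, natDegree_mul (pow_ne_zero _ X_ne_zero) h, natDegree_X_pow] at h1
  omega

theorem coeff_prod_sum [CommRing K] {ι : Type*} (s : Finset ι) (g : ι → K[X]) (n : ι → ℕ)
    (h : ∀ i ∈ s, (g i).natDegree ≤ n i) :
    (∏ i ∈ s, g i).coeff (∑ i ∈ s, n i) = ∏ i ∈ s, (g i).coeff (n i) := by
  classical
  induction s using Finset.induction_on with
  | empty => simp
  | insert a s ha ih =>
    rw [Finset.prod_insert ha, Finset.prod_insert ha, Finset.sum_insert ha,
      coeff_mul_add_eq_of_natDegree_le (h a (by simp)), ih fun i hi => h i (by simp [hi])]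
    exact (natDegree_prod_le _ _).trans (Finset.sum_le_sum fun i hi => h i (by simp [hi]))

theorem coeff_det_sum [CommRing K] {M : Matrix (Fin d) (Fin d) K[X]} {n : Fin d → ℕ}
    (h : ∀ i j, (M i j).natDegree ≤ n i) :
    M.det.coeff (∑ i, n i) = (Matrix.of fun i j => (M i j).coeff (n i)).det := by
  rw [← Matrix.det_transpose, Matrix.det_apply, ← Matrix.det_transpose (Matrix.of _),
    Matrix.det_apply, finsetSum_coeff]
  refine Finset.sum_congr rfl fun σ _ => ?_
  rw [Units.smul_def, Units.smul_def, coeff_smul]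
  simp only [Matrix.transpose_apply, Matrix.of_apply]
  rw [coeff_prod_sum _ _ _ fun i _ => h i _]

theorem coeff_X_pow_mul_iterate_derivative [CommRing K] (f : K[X]) (j : ℕ) :
    (X ^ j * derivative^[j] f).coeff f.natDegree =
      (f.natDegree.descFactorial j : K) * f.leadingCoeff := by
  rw [coeff_X_pow_mul']
  split_ifs with h
  · rw [coeff_iterate_derivative, Nat.sub_add_cancel h, nsmul_eq_mul]
    rfl
  · rw [Nat.descFactorial_of_lt (by omega)]
    simp

/-- After scaling columns by powers of `X`, the top coefficient is the product of the leading
coefficients times a determinant of descending factorials of the degrees. These being monic of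
degree `j`, it is a Vandermonde determinant in the degrees. -/
theorem det_ne_zero_of_injective_natDegree [Field K] [CharZero K] {f : Fin d → K[X]}
    (h0 : ∀ i, f i ≠ 0) (h : Function.Injective fun i => (f i).natDegree) :
    (wronskianMatrix f).det ≠ 0 := by
  intro hW
  have h1 := det_mul_pow X f
  rw [hW, mul_zero] at h1
  have h2 := coeff_det_sum (M := Matrix.of fun i j : Fin d =>
    X ^ (j : ℕ) * derivative^[(j : ℕ)] (f i)) (n := fun i => (f i).natDegree)
    fun i j => natDegree_X_pow_mul_iterate_derivative_le _ _
  rw [h1, coeff_zero] at h2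
  have h3 : (Matrix.of fun i j : Fin d => (Matrix.of (fun i j : Fin d =>
      X ^ (j : ℕ) * derivative^[(j : ℕ)] (f i)) i j).coeff (f i).natDegree) =
      Matrix.of fun i j : Fin d => (f i).leadingCoeff * (Matrix.of fun i j : Fin d =>
        ((descPochhammer K j).eval ((f i).natDegree : K))) i j := by
    ext1 i j
    simp only [Matrix.of_apply]
    rw [coeff_X_pow_mul_iterate_derivative, descPochhammer_eval_eq_descFactorial, mul_comm]
  rw [h3, Matrix.det_mul_column, ← Matrix.det_eval_matrixOfPolynomials_eq_det_vandermonde _ _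
    (fun i => descPochhammer_natDegree K i) (fun i => monic_descPochhammer K i)] at h2
  refine mul_ne_zero (Finset.prod_ne_zero_iff.2 fun i _ => leadingCoeff_ne_zero.2 (h0 i))
    (Matrix.det_vandermonde_ne_zero_iff.2 fun i j hij => h (by simpa using hij)) h2.symm

theorem det_update_add_smul [CommRing K] (f : Fin d → K[X]) {i j : Fin d} (hij : i ≠ j) (c : K) :
    (wronskianMatrix (Function.update f i (f i + c • f j))).det = (wronskianMatrix f).det := by
  rw [← Matrix.det_updateRow_add_smul_self (wronskianMatrix f) hij (C c)]
  congr 1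
  ext1 k l
  by_cases hk : k = i
  · subst hk
    simp [wronskianMatrix, smul_eq_C_mul]
  · simp [wronskianMatrix, hk]

/-- If two degrees agree, cancelling one leading term against the other keeps the Wronskian and
independence but lowers the degree sum; this ends at distinct degrees. -/
theorem det_ne_zero [Field K] [CharZero K] {f : Fin d → K[X]} (h : LinearIndependent K f) :
    (wronskianMatrix f).det ≠ 0 := by
  induction hN : ∑ i, (f i).natDegree using Nat.strong_induction_on generalizing f with
  | _ N ih =>
  by_cases hinj : Function.Injective fun i => (f i).natDegree
  · exact det_ne_zero_of_injective_natDegree (fun i => h.ne_zero i) hinj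
  · simp only [Function.Injective, not_forall] at hinj
    obtain ⟨i, j, hdeg, hij⟩ := hinj
    set c : K := -((f i).leadingCoeff / (f j).leadingCoeff) with hc
    have hlj := leadingCoeff_ne_zero.2 (h.ne_zero j)
    have hind : LinearIndependent K (Function.update f i (f i + c • f j)) := by
      rw [Fintype.linearIndependent_iff] at h ⊢
      intro g hg
      have h1 := h (Function.update g j (g j + g i * c)) (by
        rw [← hg, ← Finset.add_sum_erase _ _ (Finset.mem_univ i),
          ← Finset.add_sum_erase _ _ (Finset.mem_univ i),
          ← Finset.add_sum_erase _ _ (show j ∈ Finset.univ.erase i by simp [Ne.symm hij]),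
          ← Finset.add_sum_erase _ _ (show j ∈ Finset.univ.erase i by simp [Ne.symm hij])]
        have : ∀ k ∈ (Finset.univ.erase i).erase j,
            Function.update g j (g j + g i * c) k • f k =
              g k • Function.update f i (f i + c • f j) k := by
          intro k hk
          simp only [Finset.mem_erase] at hk
          rw [Function.update_of_ne hk.1, Function.update_of_ne hk.2.1]
        rw [Finset.sum_congr rfl this, Function.update_of_ne hij, Function.update_self,
          Function.update_self, Function.update_of_ne (Ne.symm hij)]
        module)
      have h2 : g i = 0 := by simpa [hij] using h1 i
      intro k
      by_cases hk : k = j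
      · subst hk
        simpa [h2] using h1 k
      · simpa [hk] using h1 k
    rw [← det_update_add_smul f hij c]
    refine ih _ ?_ hind rfl
    rw [← hN]
    refine Finset.sum_lt_sum (fun k _ => ?_) ⟨i, Finset.mem_univ i, ?_⟩
    · by_cases hk : k = i
      · subst hk
        rw [Function.update_self]
        refine (natDegree_add_le _ _).trans (max_le le_rfl ((natDegree_smul_le _ _).trans ?_))
        exact hdeg.ge
      · rw [Function.update_of_ne hk]
    · rw [Function.update_self]
      have hne : f i + c • f j ≠ 0 := by simpa using hind.ne_zero i
      refine (natDegree_lt_natDegree_iff hne).2 ?_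
      rw [smul_eq_C_mul, hc, C_neg, neg_mul, ← sub_eq_add_neg]
      refine degree_sub_lt_left ?_ (h.ne_zero i) ?_
      · rw [degree_C_mul (div_ne_zero (leadingCoeff_ne_zero.2 (h.ne_zero i)) hlj)]
        rw [degree_eq_natDegree (h.ne_zero i), degree_eq_natDegree (h.ne_zero j)]
        exact congrArg Nat.cast hdeg
      · rw [leadingCoeff_mul, leadingCoeff_C, div_mul_cancel₀ _ hlj]

end wronskianMatrix

/-! ### Minimal relations and subbases -/

/-- Among the relations modulo `U`, supported in `A` and with nonzero value, there is one of minimal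
support `E`; removing any element of `E` leaves a family that is independent modulo `U`. -/
theorem exists_minimal_relation {K M ι : Type*} [Field K] [AddCommGroup M] [Module K M]
    [DecidableEq ι] (f : ι → M) (U : Submodule K M) (A : Finset ι) (c₀ : ι → K)
    (hU : ∑ i ∈ A, c₀ i • f i ∈ U) (h0 : ∑ i ∈ A, c₀ i • f i ≠ 0) :
    ∃ E ⊆ A, ∃ c : ι → K, E.Nonempty ∧ ∑ i ∈ E, c i • f i ∈ U ∧ ∑ i ∈ E, c i • f i ≠ 0 ∧
      (∀ i ∈ E, c i ≠ 0) ∧ ∀ e ∈ E, ∀ b : ι → K, ∑ i ∈ E.erase e, b i • f i ∈ U →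
        ∀ i ∈ E.erase e, b i = 0 := by
  induction hn : A.card using Nat.strong_induction_on generalizing A c₀ with
  | _ n ih =>
  subst hn
  have step : ∀ e ∈ A, ∀ c : ι → K, ∑ i ∈ A.erase e, c i • f i ∈ U →
      ∑ i ∈ A.erase e, c i • f i ≠ 0 → _ := fun e he c h1 h2 =>
    ih _ (Finset.card_erase_lt_of_mem he) (A.erase e) c h1 h2 rfl
  by_cases hsmall : ∃ e ∈ A, ∃ c : ι → K, ∑ i ∈ A.erase e, c i • f i ∈ U ∧
      ∑ i ∈ A.erase e, c i • f i ≠ 0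
  · obtain ⟨e, he, c, h1, h2⟩ := hsmall
    obtain ⟨E, hE, r⟩ := step e he c h1 h2
    exact ⟨E, hE.trans (Finset.erase_subset _ _), r⟩
  · push Not at hsmall
    refine ⟨A, subset_rfl, c₀, ?_, hU, h0, fun i hi hc => ?_, fun e he b hb => ?_⟩
    · rw [Finset.nonempty_iff_ne_empty]
      rintro rfl
      simp at h0
    · have : ∑ k ∈ A.erase i, c₀ k • f k = ∑ k ∈ A, c₀ k • f k := by
        rw [← Finset.add_sum_erase _ _ hi, hc, zero_smul, zero_add]
      exact h0 (this ▸ hsmall i hi c₀ (this ▸ hU))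
    · have hb0 := hsmall e he b hb
      intro k hk
      by_contra hbk
      have hkA := Finset.mem_of_mem_erase hk
      set b' : ι → K := fun i => if i = e then 0 else b i with hb'
      have hs' : ∑ i ∈ A, b' i • f i = 0 := by
        rw [← hb0, ← Finset.add_sum_erase _ _ he]
        simp only [hb', if_true, zero_smul, zero_add]
        refine Finset.sum_congr rfl fun i hi => ?_
        rw [if_neg (Finset.ne_of_mem_erase hi)]
      have hbk' : b' k ≠ 0 := by simpa [hb', Finset.ne_of_mem_erase hk] using hbk
      -- Since `b'` is a vanishing relation, subtracting a multiple of it removes `k` from the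
      -- support of `c₀` without changing the value, against minimality.
      have hsum : ∑ i ∈ A.erase k, (c₀ i - c₀ k / b' k * b' i) • f i = ∑ i ∈ A, c₀ i • f i := by
        have : ∑ i ∈ A, (c₀ i - c₀ k / b' k * b' i) • f i = ∑ i ∈ A, c₀ i • f i := by
          simp only [sub_smul, mul_smul, Finset.sum_sub_distrib, ← Finset.smul_sum, hs', smul_zero,
            sub_zero]
        rw [← this, ← Finset.add_sum_erase _ _ hkA, div_mul_cancel₀ _ hbk', sub_self, zero_smul,
          zero_add]
      exact h0 (hsum ▸ hsmall k hkA _ (hsum ▸ hU))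

/-- `B` indexes a basis, chosen among the `f i` with `i ∈ T`, of the span of these. -/
structure IsSubbasis (K : Type*) {M ι : Type*} [Field K] [AddCommGroup M] [Module K M]
    (f : ι → M) (B T : Finset ι) : Prop where
  subset : B ⊆ T
  linearIndepOn : LinearIndepOn K f (B : Set ι)
  mem_span : ∀ i ∈ T, f i ∈ Submodule.span K (f '' B)

namespace IsSubbasis

variable {K M ι : Type*} [Field K] [AddCommGroup M] [Module K M] {f : ι → M} {B B' T : Finset ι}

theorem span_eq (h : IsSubbasis K f B T) :
    Submodule.span K (f '' B) = Submodule.span K (f '' T) := by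
  refine le_antisymm (Submodule.span_mono (Set.image_mono h.subset)) (Submodule.span_le.2 ?_)
  rintro _ ⟨i, hi, rfl⟩
  exact h.mem_span i hi

theorem card_eq_finrank (h : IsSubbasis K f B T) :
    B.card = Module.finrank K (Submodule.span K (f '' T)) := by
  rw [← h.span_eq, Set.image_eq_range]
  have := finrank_span_eq_card h.linearIndepOn
  simpa using this.symm

/-- The relation has all coefficients nonzero, so it recovers `f e` from the rest. The freedom in
`e` is what lets the basis depend on the place. -/
theorem union_erase [DecidableEq ι] (h : IsSubbasis K f B T) {E : Finset ι} (hd : Disjoint T E)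
    {c : ι → K} (hU : ∑ i ∈ E, c i • f i ∈ Submodule.span K (f '' T)) (hc : ∀ i ∈ E, c i ≠ 0)
    {e : ι} (he : e ∈ E)
    (hE : ∀ b : ι → K, ∑ i ∈ E.erase e, b i • f i ∈ Submodule.span K (f '' T) →
        ∀ i ∈ E.erase e, b i = 0) :
    IsSubbasis K f (B ∪ E.erase e) (T ∪ E) := by
  have hdB : Disjoint B (E.erase e) :=
    Finset.disjoint_of_subset_left h.subset
      (Finset.disjoint_of_subset_right (Finset.erase_subset _ _) hd)
  have hBT : Submodule.span K (f '' B) ≤ Submodule.span K (f '' (B ∪ E.erase e : Finset ι)) :=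
    Submodule.span_mono (Set.image_mono (by simp))
  have hmem : ∀ i ∈ B ∪ E.erase e, f i ∈ Submodule.span K (f '' (B ∪ E.erase e : Finset ι)) :=
    fun i hi => Submodule.subset_span ⟨i, hi, rfl⟩
  refine ⟨Finset.union_subset_union h.subset (Finset.erase_subset _ _), ?_, fun i hi => ?_⟩
  · rw [linearIndepOn_finset_iff]
    intro g hg
    rw [Finset.sum_union hdB] at hg
    have hgB : ∑ i ∈ B, g i • f i ∈ Submodule.span K (f '' T) :=
      Submodule.sum_mem _ fun i hi =>
        Submodule.smul_mem _ _ (Submodule.subset_span ⟨i, h.subset hi, rfl⟩)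
    have h1 := hE g (by
      rw [eq_neg_of_add_eq_zero_right hg]
      exact Submodule.neg_mem _ hgB)
    rw [Finset.sum_eq_zero (s := E.erase e) fun i hi => by rw [h1 i hi, zero_smul], add_zero] at hg
    have h2 := linearIndepOn_finset_iff.1 h.linearIndepOn g hg
    intro i hi
    rcases Finset.mem_union.1 hi with hi | hi
    exacts [h2 i hi, h1 i hi]
  · rcases Finset.mem_union.1 hi with hi | hi
    · exact hBT (h.mem_span i hi)
    · by_cases hie : i = e
      · subst hie
        rw [← h.span_eq] at hU
        have h1 := hBT hU
        rw [← Finset.add_sum_erase _ _ he, Submodule.add_mem_iff_left _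
          (Submodule.sum_mem _ fun j hj => Submodule.smul_mem _ _
            (hmem j (Finset.mem_union_right _ hj)))] at h1
        exact (Submodule.smul_mem_iff _ (hc _ he)).1 h1
      · exact hmem i (Finset.mem_union_right _ (Finset.mem_erase.2 ⟨hie, hi⟩))

theorem union_sdiff_union_erase [DecidableEq ι] (h : IsSubbasis K f B T) {E : Finset ι}
    (hd : Disjoint T E) {e : ι} (he : e ∈ E) :
    (T ∪ E) \ (B ∪ E.erase e) = insert e (T \ B) := by
  have h1 := h.subset
  have h2 := Finset.disjoint_left.1 hd
  ext i
  simp only [Finset.mem_sdiff, Finset.mem_union, Finset.mem_erase, Finset.mem_insert]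
  by_cases hie : i = e
  · subst hie
    have : i ∉ B := fun hB => h2 (h1 hB) he
    tauto
  · have : i ∈ T → i ∉ E := fun a => h2 a
    tauto

end IsSubbasis

/-! ### The one-variable inequality -/

namespace Polynomial

variable {K ι : Type*} [Field K]

theorem dvd_of_mem_span {f : ι → K[X]} {T : Set ι} {q h : K[X]} (hq : ∀ i ∈ T, q ∣ f i)
    (hh : h ∈ Submodule.span K (f '' T)) : q ∣ h := by
  induction hh using Submodule.span_induction with
  | mem x hx =>
    obtain ⟨i, hi, rfl⟩ := hx
    exact hq i hi
  | zero => exact dvd_zero _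
  | add x y _ _ hx hy => exact dvd_add hx hy
  | smul a x _ hx => exact hx.trans ⟨C a, by rw [smul_eq_C_mul, mul_comm]⟩

variable [DecidableEq ι]

theorem exists_gcd_finset (f : ι → K[X]) (T : Finset ι) :
    ∃ G : K[X], ∀ q, q ∣ G ↔ ∀ i ∈ T, q ∣ f i := by
  classical
  induction T using Finset.induction_on with
  | empty => exact ⟨0, by simp⟩
  | insert a s ha ih =>
    obtain ⟨G, hG⟩ := ih
    refine ⟨EuclideanDomain.gcd (f a) G, fun q => ?_⟩
    simp only [Finset.mem_insert, forall_eq_or_imp, ← hG]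
    exact ⟨fun h => ⟨h.trans (EuclideanDomain.gcd_dvd_left _ _),
      h.trans (EuclideanDomain.gcd_dvd_right _ _)⟩, fun h => EuclideanDomain.dvd_gcd h.1 h.2⟩

/-- The data controlling `deg (f m)` by the `f i` with `i ∈ T`: the polynomial `D` bounds what is
lost at the finite places when a basis is chosen among the `f i`, and `N` what is gained at
infinity. -/
def HeightBound (f : ι → K[X]) (m : ι) (T : Finset ι) : Prop :=
  ∃ (D G : K[X]) (N : ℕ), D ≠ 0 ∧ (∀ q, q ∣ G ↔ ∀ i ∈ T, q ∣ f i) ∧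
    (f m).natDegree + D.natDegree ≤ N + G.natDegree ∧
    (∀ p, Irreducible p → ∃ B, IsSubbasis K f B T ∧
      emultiplicity p (∏ i ∈ T \ B, f i) ≤ emultiplicity p D) ∧
    ∃ B, IsSubbasis K f B T ∧ N ≤ ∑ i ∈ T \ B, (f i).natDegree

theorem heightBound_singleton {f : ι → K[X]} {m : ι} (h : f m ≠ 0) : HeightBound f m {m} := by
  have hB : IsSubbasis K f {m} {m} := by
    refine ⟨subset_rfl, ?_, fun i hi => Submodule.subset_span ⟨i, by simpa using hi, rfl⟩⟩
    simpa using LinearIndepOn.singleton (R := K) (v := f) h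
  exact ⟨1, f m, 0, one_ne_zero, by simp, by simp,
    fun p _ => ⟨{m}, hB, by simp⟩, {m}, hB, by simp⟩

/-- The nonzero value `h` of a minimal relation on a new block `E` lies in the span of the old
polynomials, so both the old gcd `G` and the gcd `GE` of the block divide it. Hence `deg G + deg GE
≤ deg (gcd G GE) + deg h`, which pays for multiplying `D` by `GE`. -/
theorem HeightBound.step {f : ι → K[X]} {m : ι} {S T : Finset ι} (hf : ∀ i ∈ S, f i ≠ 0)
    (hTS : T ⊆ S) (hT : T.Nonempty) (hsum : ∑ i ∈ S, f i = 0) (hTsum : ∑ i ∈ T, f i ≠ 0)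
    (h : HeightBound f m T) : ∃ T', T ⊂ T' ∧ T' ⊆ S ∧ HeightBound f m T' := by
  classical
  obtain ⟨D, G, N, hD, hG, hdeg, hfin, Binf, hBinf, hN⟩ := h
  have hTmem : ∑ i ∈ T, f i ∈ Submodule.span K (f '' T) :=
    Submodule.sum_mem _ fun i hi => Submodule.subset_span ⟨i, hi, rfl⟩
  -- The complementary subsum is a first relation modulo the span of `T`; its value is nonzero
  -- because the subsum over `T` is.
  have hcompl : ∑ i ∈ S \ T, (1 : K) • f i = -∑ i ∈ T, f i := by
    rw [eq_neg_iff_add_eq_zero, ← hsum, ← Finset.sum_sdiff hTS]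
    simp
  obtain ⟨E, hES, c, hEne, hEU, hE0, hc, hind⟩ := exists_minimal_relation f
    (Submodule.span K (f '' T)) (S \ T) (fun _ => 1)
    (by rw [hcompl]; exact Submodule.neg_mem _ hTmem) (by rw [hcompl]; exact neg_ne_zero.2 hTsum)
  have hdisj : Disjoint T E := Finset.disjoint_of_subset_right hES Finset.disjoint_sdiff
  have hE_S : E ⊆ S := hES.trans Finset.sdiff_subset
  obtain ⟨GE, hGE⟩ := exists_gcd_finset f E
  have hG0 : G ≠ 0 := by
    rintro rfl
    obtain ⟨i, hi⟩ := hT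
    exact hf i (hTS hi) (zero_dvd_iff.1 ((hG 0).1 dvd_rfl i hi))
  have hGE0 : GE ≠ 0 := by
    rintro rfl
    obtain ⟨i, hi⟩ := hEne
    exact hf i (hE_S hi) (zero_dvd_iff.1 ((hGE 0).1 dvd_rfl i hi))
  obtain ⟨e, heE, he⟩ := Finset.exists_max_image E (fun i => (f i).natDegree) hEne
  set h := ∑ i ∈ E, c i • f i with hh
  have hGh : G ∣ h := dvd_of_mem_span ((hG G).1 dvd_rfl) hEU
  have hGEh : GE ∣ h := Finset.dvd_sum fun i hi =>
    ((hGE GE).1 dvd_rfl i hi).trans ⟨C (c i), by rw [smul_eq_C_mul, mul_comm]⟩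
  have hhdeg : h.natDegree ≤ (f e).natDegree :=
    natDegree_sum_le_of_forall_le _ _ fun i hi => (natDegree_smul_le _ _).trans (he i hi)
  set G' := EuclideanDomain.gcd G GE with hG'
  have hG'0 : G' ≠ 0 := fun h0 => hG0 (EuclideanDomain.gcd_eq_zero_iff.1 h0).1
  have hlcm : G.natDegree + GE.natDegree ≤ G'.natDegree + h.natDegree := by
    rw [← natDegree_mul hG0 hGE0, ← natDegree_mul hG'0 hE0]
    refine natDegree_le_of_dvd ?_ (mul_ne_zero hG'0 hE0)
    rw [← EuclideanDomain.gcd_mul_lcm]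
    exact mul_dvd_mul_left _ (EuclideanDomain.lcm_dvd hGh hGEh)
  have hsd : ∀ {B e}, IsSubbasis K f B T → e ∈ E → e ∉ T \ B := fun _ heE he =>
    Finset.disjoint_left.1 hdisj (Finset.mem_sdiff.1 he).1 heE
  refine ⟨T ∪ E, ?_, Finset.union_subset hTS hE_S, D * GE, G', N + (f e).natDegree,
    mul_ne_zero hD hGE0, fun q => ?_, ?_, fun p hp => ?_, Binf ∪ E.erase e,
    hBinf.union_erase hdisj hEU hc heE (hind e heE), ?_⟩
  · refine Finset.ssubset_iff_subset_ne.2 ⟨Finset.subset_union_left, fun heq => ?_⟩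
    exact Finset.disjoint_left.1 hdisj (heq ▸ Finset.mem_union_right _ heE) heE
  · simp only [Finset.mem_union, or_imp, forall_and, ← hG, ← hGE]
    exact ⟨fun h => ⟨h.trans (EuclideanDomain.gcd_dvd_left _ _),
      h.trans (EuclideanDomain.gcd_dvd_right _ _)⟩, fun h => EuclideanDomain.dvd_gcd h.1 h.2⟩
  · rw [natDegree_mul hD hGE0]
    omega
  · obtain ⟨B, hB, hBD⟩ := hfin p hp
    -- The dropped element of least multiplicity contributes no more at `p` than `GE` does.
    obtain ⟨e', he'E, he'⟩ := Finset.exists_min_image E (fun i => emultiplicity p (f i)) hEne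
    refine ⟨B ∪ E.erase e', hB.union_erase hdisj hEU hc he'E (hind e' he'E), ?_⟩
    rw [hB.union_sdiff_union_erase hdisj he'E, Finset.prod_insert (hsd hB he'E),
      emultiplicity_mul hp.prime, emultiplicity_mul hp.prime, add_comm]
    refine add_le_add hBD (emultiplicity_le_emultiplicity_iff.2 fun n hn => ?_)
    rw [hGE]
    intro i hi
    rw [pow_dvd_iff_le_emultiplicity] at hn ⊢
    exact hn.trans (he' i hi)
  · rw [hBinf.union_sdiff_union_erase hdisj heE, Finset.sum_insert (hsd hBinf heE)]
    omega

theorem heightBound_of_sum_eq_zero {f : ι → K[X]} {m : ι} {S : Finset ι} (hm : m ∈ S)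
    (hf : ∀ i ∈ S, f i ≠ 0) (hsum : ∑ i ∈ S, f i = 0)
    (hsub : ∀ T ⊂ S, T.Nonempty → ∑ i ∈ T, f i ≠ 0) : HeightBound f m S := by
  suffices key : ∀ k (T : Finset ι), (S \ T).card = k → m ∈ T → T ⊆ S → HeightBound f m T →
      HeightBound f m S from
    key _ {m} rfl (by simp) (by simpa using hm) (heightBound_singleton (hf m hm))
  intro k
  induction k using Nat.strong_induction_on with
  | _ k ih =>
  intro T hk hmT hTS hT
  rcases eq_or_ne T S with rfl | hne
  · exact hT
  · have hne' : T ⊂ S := Finset.ssubset_iff_subset_ne.2 ⟨hTS, hne⟩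
    obtain ⟨T', hTT', hT'S, hT'⟩ := hT.step hf hTS ⟨m, hmT⟩ hsum (hsub T hne' ⟨m, hmT⟩)
    refine ih _ ?_ T' rfl (hTT'.1 hmT) hT'S hT'
    rw [← hk]
    refine Finset.card_lt_card (Finset.ssubset_iff_of_subset
      (Finset.sdiff_subset_sdiff subset_rfl hTT'.1) |>.2 ?_)
    obtain ⟨x, hx, hxT⟩ := Finset.exists_of_ssubset hTT'
    exact ⟨x, by simp [hT'S hx, hxT], by simp [hx]⟩

/-- The Wronskians of two families of the `f i` that enumerate subbases divide one another. -/
theorem exists_wronskianMatrix_dvd {f : ι → K[X]} {B B' S : Finset ι} (hB : IsSubbasis K f B S)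
    (hB' : IsSubbasis K f B' S) {d : ℕ} (b b' : Fin d → ι) (hb : Finset.univ.image b ⊆ B)
    (hb' : B' ⊆ Finset.univ.image b') :
    (wronskianMatrix (f ∘ b')).det ∣ (wronskianMatrix (f ∘ b)).det := by
  have h1 : ∀ i, ∃ a : Fin d → K, ∑ k, a k • f (b' k) = f (b i) := by
    intro i
    have h2 : f (b i) ∈ Submodule.span K (Set.range (f ∘ b')) := by
      refine Submodule.span_mono ?_ (hB'.mem_span _ (hB.subset (hb (by simp))))
      rintro _ ⟨j, hj, rfl⟩
      obtain ⟨k, -, rfl⟩ := Finset.mem_image.1 (hb' hj)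
      exact ⟨k, rfl⟩
    exact (Submodule.mem_span_range_iff_exists_fun K).1 h2
  choose A hA using h1
  rw [wronskianMatrix.det_of_eq_sum (f := f ∘ b) (g := f ∘ b') (Matrix.of A)
    (fun i => (hA i).symm)]
  exact dvd_mul_left _ _

theorem emultiplicity_prod_le_wronskianMatrix {d : ℕ} {p : K[X]} (hp : Irreducible p)
    {f : Fin d → K[X]} (hf : ∀ i, f i ≠ 0) :
    emultiplicity p (∏ i, f i) ≤
      (∑ j : Fin d, (j : ℕ) : ℕ) + emultiplicity p (wronskianMatrix f).det := by
  have hfin : ∀ i, FiniteMultiplicity p (f i) := fun i =>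
    FiniteMultiplicity.of_not_isUnit hp.not_isUnit (hf i)
  have h1 := wronskianMatrix.pow_sum_dvd (p := p) (f := f) (n := fun i => multiplicity p (f i))
    fun i => pow_multiplicity_dvd p (f i)
  rw [pow_dvd_iff_le_emultiplicity, emultiplicity_mul hp.prime,
    emultiplicity_pow_self_of_prime hp.prime] at h1
  refine le_trans (le_of_eq ?_) h1
  rw [Finset.emultiplicity_prod hp.prime, Nat.cast_sum]
  exact Finset.sum_congr rfl fun i _ => (hfin i).emultiplicity_eq_multiplicity

/-- A truncated Mason–Stothers inequality for a sum without vanishing subsums. -/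
theorem exists_natDegree_add_le [CharZero K] {f : ι → K[X]} {m : ι} {S : Finset ι} (hm : m ∈ S)
    (hf : ∀ i ∈ S, f i ≠ 0) (hsum : ∑ i ∈ S, f i = 0)
    (hsub : ∀ T ⊂ S, T.Nonempty → ∑ i ∈ T, f i ≠ 0)
    (hgcd : ∀ q, (∀ i ∈ S, q ∣ f i) → IsUnit q) :
    ∃ B ⊆ S, LinearIndepOn K f (B : Set ι) ∧ ∀ Q : K[X], Q ≠ 0 →
      (∀ p, Irreducible p → ∀ k ≤ ∑ j : Fin B.card, (j : ℕ), p ^ k ∣ ∏ i ∈ S, f i → p ^ k ∣ Q) →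
      (f m).natDegree + ∑ j : Fin B.card, (j : ℕ) ≤ Q.natDegree := by
  obtain ⟨D, G, N, hD, hG, hdeg, hfin, B, hB, hN⟩ := heightBound_of_sum_eq_zero hm hf hsum hsub
  have hGdeg : G.natDegree = 0 :=
    natDegree_eq_zero_of_isUnit (hgcd G ((hG G).1 dvd_rfl))
  -- `Q` stays arbitrary so that a truncation formed before restriction to a line can be inserted.
  refine ⟨B, hB.subset, hB.linearIndepOn, fun Q hQ hQdvd => ?_⟩
  have enum : ∀ B', IsSubbasis K f B' S → ∃ b' : Fin B.card → ι, Finset.univ.image b' = B' ∧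
      Function.Injective b' := by
    intro B' hB'
    have hcard : B'.card = B.card := by rw [hB'.card_eq_finrank, hB.card_eq_finrank]
    refine ⟨fun i => (B'.equivFinOfCardEq hcard).symm i, ?_, fun i j hij => ?_⟩
    · ext x
      simp only [Finset.mem_image, Finset.mem_univ, true_and]
      constructor
      · rintro ⟨i, rfl⟩
        exact Subtype.property _
      · intro hx
        exact ⟨B'.equivFinOfCardEq hcard ⟨x, hx⟩, by simp⟩
    · exact (B'.equivFinOfCardEq hcard).symm.injective (Subtype.ext hij)
  obtain ⟨b, hb, hbinj⟩ := enum B hB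
  have hbB : ∀ i, b i ∈ B := fun i => hb ▸ Finset.mem_image_of_mem b (Finset.mem_univ i)
  set W := (wronskianMatrix (f ∘ b)).det with hW
  set s := ∑ j : Fin B.card, (j : ℕ) with hs
  have hW0 : W ≠ 0 := by
    refine wronskianMatrix.det_ne_zero ?_
    exact hB.linearIndepOn.comp (fun i => (⟨b i, hbB i⟩ : (B : Set ι)))
      fun i j hij => hbinj (congrArg Subtype.val hij)
  have hWdeg : W.natDegree + s ≤ _ := wronskianMatrix.natDegree_det_add_le hW0
  have hsumB : ∑ i, ((f ∘ b) i).natDegree = ∑ i ∈ B, (f i).natDegree :=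
    (Finset.sum_image (f := fun i => (f i).natDegree) fun i _ j _ hij => hbinj hij).symm.trans
      (by rw [hb])
  have hP0 : ∏ i ∈ S, f i ≠ 0 := Finset.prod_ne_zero_iff.2 hf
  have hdvd : ∏ i ∈ S, f i ∣ D * W * Q := by
    rw [UniqueFactorizationMonoid.dvd_iff_emultiplicity_le hP0]
    intro p hp
    have hp : Irreducible p := by first | exact hp | exact hp.irreducible
    obtain ⟨B', hB', hBD⟩ := hfin p hp
    obtain ⟨b', hb', hbinj'⟩ := enum B' hB'
    have hWW : emultiplicity p (wronskianMatrix (f ∘ b')).det ≤ emultiplicity p W :=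
      emultiplicity_le_emultiplicity_of_dvd_right
        (exists_wronskianMatrix_dvd hB hB' b b' hb.le hb'.ge)
    have hprod : ∏ i ∈ B', f i = ∏ i, (f ∘ b') i := by
      rw [← hb', Finset.prod_image fun i _ j _ hij => hbinj' hij]
      rfl
    have hmain : emultiplicity p (∏ i ∈ S, f i) ≤
        emultiplicity p D + emultiplicity p W + (s : ℕ∞) := by
      rw [← Finset.prod_sdiff hB'.subset, emultiplicity_mul hp.prime, hprod, add_assoc]
      refine add_le_add hBD ?_
      rw [add_comm]
      refine (emultiplicity_prod_le_wronskianMatrix hp fun i => ?_).trans (add_le_add le_rfl hWW)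
      refine hf _ (hB'.subset ?_)
      rw [← hb']
      simp
    rw [emultiplicity_mul hp.prime, emultiplicity_mul hp.prime]
    -- Either `Q` absorbs the full Wronskian loss `s` at `p`, or the product has multiplicity below
    -- `s` there and `Q` contains all of it.
    by_cases hps : p ^ s ∣ ∏ i ∈ S, f i
    · refine hmain.trans (add_le_add le_rfl ?_)
      exact pow_dvd_iff_le_emultiplicity.1 (hQdvd p hp s le_rfl hps)
    · refine le_trans ?_ le_add_self
      refine emultiplicity_le_emultiplicity_iff.2 fun n hn => hQdvd p hp n ?_ hn
      by_contra hns
      exact hps ((pow_dvd_pow p (by omega)).trans hn)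
  have hdeg' := natDegree_le_of_dvd hdvd (mul_ne_zero (mul_ne_zero hD hW0) hQ)
  rw [natDegree_mul (mul_ne_zero hD hW0) hQ, natDegree_mul hD hW0, natDegree_prod _ _ hf,
    ← Finset.sum_sdiff hB.subset] at hdeg'
  omega

end Polynomial

/-! ### Coprimality over the field of fractions -/

namespace Polynomial

open scoped nonZeroDivisors in
/-- Coprimality of finitely many polynomials over a unique factorization domain is inherited by
the polynomials over the field of fractions. -/
theorem isUnit_of_forall_dvd_map {R K ι : Type*} [CommRing R] [IsDomain R]
    [UniqueFactorizationMonoid R] [Field K] [Algebra R K] [IsFractionRing R K] {f : ι → R[X]}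
    {S : Finset ι} (hne : ∃ i ∈ S, f i ≠ 0) (h : ∀ q, (∀ i ∈ S, q ∣ f i) → IsUnit q) {q : K[X]}
    (hq : ∀ i ∈ S, q ∣ (f i).map (algebraMap R K)) : IsUnit q := by
  obtain ⟨_⟩ : Nonempty (NormalizedGCDMonoid R) :=
    letI := UniqueFactorizationMonoid.strongNormalizationMonoid (α := R)
    letI := UniqueFactorizationMonoid.toStrongNormalizedGCDMonoid R
    ⟨inferInstance⟩
  have hq0 : q ≠ 0 := by
    rintro rfl
    obtain ⟨i, hi, hi0⟩ := hne
    exact hi0 ((Polynomial.map_eq_zero_iff (IsFractionRing.injective R K)).1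
      (zero_dvd_iff.1 (hq i hi)))
  -- By Gauss's lemma, the primitive part of `q` with denominators cleared already divides every `f
  -- i` over `R`.
  refine isUnit_or_eq_zero_of_isUnit_integerNormalization_primPart (R := R) hq0 (h _ fun i hi => ?_)
  refine (isPrimitive_primPart _).dvd_of_fraction_map_dvd_fraction_map (K := K) ?_
  refine Dvd.dvd.trans ?_ (hq i hi)
  obtain ⟨c, hc, hcq⟩ := IsLocalization.integerNormalization_spec R⁰ q
  have h1 : (IsLocalization.integerNormalization R⁰ q).primPart.map (algebraMap R K) ∣ c • q := by
    rw [← hcq]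
    exact Polynomial.map_dvd _ (primPart_dvd _)
  refine h1.trans ?_
  rw [algebra_compatible_smul K c q, smul_eq_C_mul]
  exact (IsUnit.mul_left_dvd (isUnit_C.2 (isUnit_iff_ne_zero.2 ((map_ne_zero_iff _
    (IsFractionRing.injective R K)).2 (nonZeroDivisors.ne_zero hc))))).2 dvd_rfl

end Polynomial

/-! ### Restriction to a generic line -/

namespace MvPolynomial

variable {σ k : Type*} [Field k]

/-- Restriction of a polynomial to the generic line with direction `a`: `x ↦ x + t a`. -/
noncomputable def lineHom (a : σ → k) : MvPolynomial σ k →+* Polynomial (MvPolynomial σ k) :=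
  eval₂Hom (Polynomial.C.comp C) fun i => Polynomial.C (X i) + Polynomial.C (C (a i)) * Polynomial.X

/-- The automorphism `x ↦ x + t a`, `t ↦ t` of the polynomial ring in `x` and `t`. -/
noncomputable def lineShift (a : σ → k) :
    Polynomial (MvPolynomial σ k) →+* Polynomial (MvPolynomial σ k) :=
  Polynomial.eval₂RingHom (lineHom a) Polynomial.X

theorem lineHom_C (a : σ → k) (c : k) : lineHom a (C c) = Polynomial.C (C c) := by
  simp [lineHom]

theorem lineHom_X (a : σ → k) (i : σ) :
    lineHom a (X i) = Polynomial.C (X i) + Polynomial.C (C (a i)) * Polynomial.X := by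
  simp [lineHom]

theorem lineShift_C (a : σ → k) (p : MvPolynomial σ k) :
    lineShift a (Polynomial.C p) = lineHom a p := by
  simp [lineShift]

theorem lineShift_lineShift {a b : σ → k} (h : ∀ i, a i + b i = 0)
    (p : Polynomial (MvPolynomial σ k)) : lineShift a (lineShift b p) = p := by
  have : (lineShift a).comp (lineShift b) = RingHom.id _ := by
    refine Polynomial.ringHom_ext' (MvPolynomial.ringHom_ext (fun c => ?_) fun i => ?_) ?_
    · simp [lineShift_C, lineHom_C]
    · simp only [RingHom.comp_apply, lineShift_C, lineHom_X, map_add, map_mul, lineHom_C,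
        RingHom.id_apply]
      simp only [lineShift, Polynomial.coe_eval₂RingHom, Polynomial.eval₂_X]
      rw [add_assoc, ← add_mul, ← Polynomial.C_add, ← C_add, h, C_0, Polynomial.C_0, zero_mul,
        add_zero]
    · simp [lineShift]
  exact RingHom.congr_fun this p

theorem lineHom_injective (a : σ → k) : Function.Injective (lineHom a) := by
  intro p q h
  rw [← lineShift_C, ← lineShift_C] at h
  have h1 := congrArg (lineShift (-a)) h
  rw [lineShift_lineShift (by simp), lineShift_lineShift (by simp)] at h1
  exact Polynomial.C_injective h1

/-- Undoing the shift turns the `lineHom a (f i)` into constants in `t`, so a common divisor becomes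
a constant dividing all `f i`. -/
theorem isUnit_of_forall_dvd_lineHom {ι : Type*} (a : σ → k) {f : ι → MvPolynomial σ k}
    {S : Finset ι} (hne : ∃ i ∈ S, f i ≠ 0) (h : ∀ q, (∀ i ∈ S, q ∣ f i) → IsUnit q)
    {q : Polynomial (MvPolynomial σ k)} (hq : ∀ i ∈ S, q ∣ lineHom a (f i)) : IsUnit q := by
  have h1 : ∀ i ∈ S, lineShift (-a) q ∣ Polynomial.C (f i) := by
    intro i hi
    have := map_dvd (lineShift (-a)) (hq i hi)
    rwa [← lineShift_C, lineShift_lineShift (by simp)] at this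
  obtain ⟨r, hr⟩ : ∃ r, lineShift (-a) q = Polynomial.C r := by
    obtain ⟨i, hi, hi0⟩ := hne
    refine ⟨_, Polynomial.eq_C_of_natDegree_eq_zero ?_⟩
    have := Polynomial.natDegree_le_of_dvd (h1 i hi) (Polynomial.C_ne_zero.2 hi0)
    simpa using this
  have hru : IsUnit r := h r fun i hi => by
    have := h1 i hi
    rw [hr, Polynomial.C_dvd_iff_dvd_coeff] at this
    simpa using this 0
  have h2 : q = lineShift a (Polynomial.C r) := by
    rw [← hr, lineShift_lineShift (by simp)]
  rw [h2]
  exact (hru.map Polynomial.C).map (lineShift a)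

theorem natDegree_lineHom_le (a : σ → k) (p : MvPolynomial σ k) :
    (lineHom a p).natDegree ≤ p.totalDegree := by
  rw [lineHom, coe_eval₂Hom, eval₂_eq]
  refine Polynomial.natDegree_sum_le_of_forall_le _ _ fun d hd => ?_
  refine (Polynomial.natDegree_C_mul_le _ _).trans ((Polynomial.natDegree_prod_le _ _).trans ?_)
  refine le_trans (Finset.sum_le_sum fun i _ => ?_) (le_totalDegree hd)
  refine Polynomial.natDegree_pow_le.trans ?_
  have : (Polynomial.C (X i) + Polynomial.C (C (a i)) * Polynomial.X :
      Polynomial (MvPolynomial σ k)).natDegree ≤ 1 := by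
    rw [add_comm]
    exact Polynomial.natDegree_linear_le
  exact (Nat.mul_le_mul_left _ this).trans (by simp)

/-- At `x = 0`, the coefficient of `t` to the total degree is the top homogeneous part evaluated at
`a`, which is nonzero for some `a`. -/
theorem exists_totalDegree_le_natDegree_lineHom [Infinite k] (p : MvPolynomial σ k) :
    ∃ a : σ → k, p.totalDegree ≤ (lineHom a p).natDegree := by
  by_cases hp : p.totalDegree = 0
  · exact ⟨0, by simp [hp]⟩
  have hp0 : p ≠ 0 := by
    rintro rfl
    simp at hp
  have htop : homogeneousComponent p.totalDegree p ≠ 0 := by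
    obtain ⟨d, hd, hdeg⟩ := Finset.exists_mem_eq_sup p.support (support_nonempty.2 hp0)
      fun d => d.sum fun _ e => e
    intro h
    have h1 := congrArg (coeff d) h
    rw [coeff_homogeneousComponent, if_pos, coeff_zero] at h1
    · exact mem_support_iff.1 hd h1
    · exact hdeg.symm
  obtain ⟨a, ha⟩ : ∃ a, eval a (homogeneousComponent p.totalDegree p) ≠ 0 := by
    by_contra! h
    exact htop (MvPolynomial.funext fun a => by simpa using h a)
  refine ⟨a, Polynomial.le_natDegree_of_ne_zero fun h0 => ha ?_⟩
  have hmap : (lineHom a p).map constantCoeff =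
      aeval (fun i => Polynomial.C (a i) * Polynomial.X) p := by
    have : (Polynomial.mapRingHom constantCoeff).comp (lineHom a) =
        (aeval (R := k) fun i => Polynomial.C (a i) * Polynomial.X : _ →ₐ[k] Polynomial k) := by
      refine MvPolynomial.ringHom_ext (fun c => ?_) fun i => ?_
      · simp only [RingHom.comp_apply, lineHom_C, Polynomial.coe_mapRingHom, Polynomial.map_C,
          constantCoeff_C]
        exact (aeval_C _ c).symm
      · simp [lineHom_X]
    exact RingHom.congr_fun this p
  have hhom : ∀ n, aeval (fun i => Polynomial.C (a i) * Polynomial.X) (homogeneousComponent n p) =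
      Polynomial.C (eval a (homogeneousComponent n p)) * Polynomial.X ^ n := by
    intro n
    rw [aeval_def, eval₂_eq, eval_eq, map_sum, Finset.sum_mul]
    refine Finset.sum_congr rfl fun d hd => ?_
    have hdn : ∑ i ∈ d.support, d i = n := by
      rw [mem_support_iff, coeff_homogeneousComponent] at hd
      by_contra hne
      exact hd (if_neg hne)
    simp only [mul_pow, Finset.prod_mul_distrib, Finset.prod_pow_eq_pow_sum, hdn, map_mul,
      map_prod, map_pow, Polynomial.C_eq_algebraMap]
    ring
  have h1 : ((lineHom a p).map constantCoeff).coeff p.totalDegree = 0 := by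
    rw [Polynomial.coeff_map, h0, map_zero]
  rw [hmap] at h1
  conv at h1 => lhs; lhs; rw [← sum_homogeneousComponent p]
  rw [map_sum, Polynomial.finsetSum_coeff, Finset.sum_eq_single p.totalDegree] at h1
  · simpa [hhom] using h1
  · intro n _ hn
    rw [hhom, Polynomial.coeff_C_mul_X_pow, if_neg (Ne.symm hn)]
  · simp

end MvPolynomial

/-! ### Truncation under ring homomorphisms -/

theorem exists_prime_dvd_of_prime_dvd_map {A B : Type*} [CommRing A] [IsDomain A]
    [UniqueFactorizationMonoid A] [CommRing B] (φ : A →+* B) {q : B} (hq : Prime q) {c : A}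
    (hc : c ≠ 0) (h : q ∣ φ c) : ∃ p, Prime p ∧ p ∣ c ∧ q ∣ φ p := by
  induction c using UniqueFactorizationMonoid.induction_on_prime with
  | h₁ => exact absurd rfl hc
  | h₂ x hx => exact absurd (isUnit_of_dvd_unit h (hx.map φ)) hq.not_isUnit
  | h₃ x p hx hp ih =>
    rw [map_mul] at h
    rcases hq.dvd_or_dvd h with h | h
    · exact ⟨p, hp, dvd_mul_right _ _, h⟩
    · obtain ⟨p', hp', hd, hq'⟩ := ih hx h
      exact ⟨p', hp', hd.mul_left _, hq'⟩

section truncPart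

variable {l : ℕ}

theorem truncPart_dvd (s : ℕ) (P : MvPolynomial (Fin l) ℂ) : truncPart s P ∣ P :=
  gcd_dvd_left _ _

theorem pow_dvd_truncPart {s : ℕ} {P c p : MvPolynomial (Fin l) ℂ} (hP : P ≠ 0)
    (hc : P = truncPart s P * c) (hp : Prime p) (hpc : p ∣ c) : p ^ s ∣ truncPart s P := by
  have hpr : p ∣ sqfreePart P :=
    (UniqueFactorizationMonoid.dvd_radical_iff_of_irreducible hp.irreducible hP).2
      (hc ▸ hpc.mul_left _)
  have key : ∀ j ≤ s, p ^ j ∣ truncPart s P := by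
    intro j
    induction j with
    | zero => simp
    | succ j ih =>
      intro hj
      refine dvd_gcd ?_ ((pow_dvd_pow p hj).trans (pow_dvd_pow_of_dvd hpr s))
      have h1 := mul_dvd_mul (ih (by omega)) hpc
      rwa [← hc, ← pow_succ] at h1
  exact key s le_rfl

/-- Write `P = truncPart s P * c`. If `q` divides `φ c`, it divides the image of some prime `p` of
`c`, and such a `p` has `p ^ s` in the truncation. Otherwise `φ c` contributes nothing at `q`. -/
theorem pow_dvd_map_truncPart {B : Type*} [CommRing B] [IsDomain B]
    (φ : MvPolynomial (Fin l) ℂ →+* B) {s k : ℕ} (hk : k ≤ s) {P : MvPolynomial (Fin l) ℂ}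
    (hP : P ≠ 0) {q : B} (hq : Prime q) (h : q ^ k ∣ φ P) : q ^ k ∣ φ (truncPart s P) := by
  obtain ⟨c, hc⟩ := truncPart_dvd s P
  by_cases hqc : q ∣ φ c
  · have hc0 : c ≠ 0 := by
      rintro rfl
      exact hP (by rw [hc, mul_zero])
    obtain ⟨p, hp, hpc, hqp⟩ := exists_prime_dvd_of_prime_dvd_map φ hq hc0 hqc
    have h1 := map_dvd φ (pow_dvd_truncPart hP hc hp hpc)
    rw [map_pow] at h1
    exact (pow_dvd_pow q hk).trans ((pow_dvd_pow_of_dvd hqp s).trans h1)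
  · rw [hc, map_mul] at h
    exact hq.pow_dvd_of_dvd_mul_right k hqc h

theorem truncRadDeg_le (s : ℕ) (P : MvPolynomial (Fin l) ℂ) : truncRadDeg s P ≤ s * radDeg P := by
  have h0 : sqfreePart P ^ s ≠ 0 := pow_ne_zero _ UniqueFactorizationMonoid.radical_ne_zero
  obtain ⟨c, hc⟩ : truncPart s P ∣ sqfreePart P ^ s := gcd_dvd_right _ _
  have h1 : (sqfreePart P ^ s).totalDegree = (truncPart s P).totalDegree + c.totalDegree := by
    rw [hc] at h0 ⊢
    exact MvPolynomial.totalDegree_mul_of_isDomain (left_ne_zero_of_mul h0)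
      (right_ne_zero_of_mul h0)
  have h2 := MvPolynomial.totalDegree_pow (sqfreePart P) s
  rw [truncRadDeg, radDeg]
  omega

end truncPart

/-! ### Assembly -/

/-- Take least cardinality: were a proper nonempty subsum to vanish, so would its complement, and
one of the two contains `m`. -/
theorem exists_minimal_zero_sum {M ι : Type*} [AddCommGroup M] (f : ι → M)
    {A : Finset ι} {m : ι} (hm : m ∈ A) (h : ∑ i ∈ A, f i = 0) :
    ∃ S ⊆ A, m ∈ S ∧ ∑ i ∈ S, f i = 0 ∧ ∀ T ⊂ S, T.Nonempty → ∑ i ∈ T, f i ≠ 0 := by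
  classical
  obtain ⟨S, hS, hmin⟩ := Finset.exists_min_image
    (A.powerset.filter fun S => m ∈ S ∧ ∑ i ∈ S, f i = 0) Finset.card ⟨A, by simp [hm, h]⟩
  simp only [Finset.mem_filter, Finset.mem_powerset] at hS hmin
  obtain ⟨hSA, hmS, hS0⟩ := hS
  refine ⟨S, hSA, hmS, hS0, fun T hT hTne hT0 => ?_⟩
  by_cases hmT : m ∈ T
  · exact absurd (hmin T ⟨hT.1.trans hSA, hmT, hT0⟩) (Finset.card_lt_card hT).not_ge
  · have h1 : ∑ i ∈ S \ T, f i = 0 := by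
      rw [← Finset.sum_sdiff hT.1, hT0, add_zero] at hS0
      exact hS0
    refine absurd (hmin (S \ T) ⟨Finset.sdiff_subset.trans hSA, by simp [hmS, hmT], h1⟩) ?_
    exact (Finset.card_lt_card (Finset.sdiff_ssubset hT.1 hTne)).not_ge

/-- The main inequality for a coprime zero sum without vanishing subsums. -/
theorem exists_totalDegree_add_le {l : ℕ} {ι : Type*} [DecidableEq ι]
    {f : ι → MvPolynomial (Fin l) ℂ} {S : Finset ι} {m : ι} (hm : m ∈ S)
    (hf : ∀ i ∈ S, f i ≠ 0) (hsum : ∑ i ∈ S, f i = 0)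
    (hsub : ∀ T ⊂ S, T.Nonempty → ∑ i ∈ T, f i ≠ 0)
    (hgcd : ∀ q, (∀ i ∈ S, q ∣ f i) → IsUnit q) {P : MvPolynomial (Fin l) ℂ} (hP : P ≠ 0)
    (hSP : ∏ i ∈ S, f i ∣ P) :
    ∃ B ⊆ S, LinearIndepOn ℂ f (B : Set ι) ∧
      (f m).totalDegree + ∑ j : Fin B.card, (j : ℕ) ≤
        truncRadDeg (∑ j : Fin B.card, (j : ℕ)) P := by
  -- Only `f m` must keep its degree; for the truncation an upper bound suffices.
  obtain ⟨a, ha⟩ := MvPolynomial.exists_totalDegree_le_natDegree_lineHom (f m)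
  let R := MvPolynomial (Fin l) ℂ
  let K := FractionRing R
  have hinjK : Function.Injective (algebraMap R K) := IsFractionRing.injective R K
  have : CharZero K := charZero_of_injective_algebraMap (R := R) hinjK
  let φ : R →+* Polynomial K := (Polynomial.mapRingHom (algebraMap R K)).comp
    (MvPolynomial.lineHom a)
  have hφ : Function.Injective φ :=
    (Polynomial.map_injective _ hinjK).comp (MvPolynomial.lineHom_injective a)
  have hφdeg : ∀ p, (φ p).natDegree = (MvPolynomial.lineHom a p).natDegree := fun p =>
    Polynomial.natDegree_map_eq_of_injective hinjK _
  have hφsmul : ∀ (c : ℂ) (p : R), φ (c • p) = algebraMap R K (MvPolynomial.C c) • φ p := by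
    intro c p
    have hC : φ (MvPolynomial.C c) = Polynomial.C (algebraMap R K (MvPolynomial.C c)) := by
      change Polynomial.map _ (MvPolynomial.lineHom a (MvPolynomial.C c)) = _
      rw [MvPolynomial.lineHom_C, Polynomial.map_C]
    rw [MvPolynomial.smul_eq_C_mul, map_mul, Polynomial.smul_eq_C_mul, hC]
  obtain ⟨B, hBS, hB, hmain⟩ := Polynomial.exists_natDegree_add_le (f := fun i => φ (f i)) hm
    (fun i hi => (map_ne_zero_iff φ hφ).2 (hf i hi)) (by rw [← map_sum, hsum, map_zero])
    (fun T hT hTne => by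
      rw [← map_sum]
      exact (map_ne_zero_iff φ hφ).2 (hsub T hT hTne))
    (fun q hq => Polynomial.isUnit_of_forall_dvd_map (f := fun i => MvPolynomial.lineHom a (f i))
      ⟨m, hm, (map_ne_zero_iff _ (MvPolynomial.lineHom_injective a)).2 (hf m hm)⟩
      (fun q hq => MvPolynomial.isUnit_of_forall_dvd_lineHom a ⟨m, hm, hf m hm⟩ hgcd hq) hq)
  refine ⟨B, hBS, ?_, ?_⟩
  · rw [linearIndepOn_finset_iff] at hB ⊢
    intro g hg i hi
    have h1 := hB (fun i => algebraMap R K (MvPolynomial.C (g i))) (by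
      simp only [← hφsmul]
      rw [← map_sum, hg, map_zero]) i hi
    simpa using h1
  · have hT0 : truncPart (∑ j : Fin B.card, (j : ℕ)) P ≠ 0 :=
      ne_zero_of_dvd_ne_zero hP (truncPart_dvd _ P)
    have h1 := hmain (φ (truncPart (∑ j : Fin B.card, (j : ℕ)) P))
      ((map_ne_zero_iff φ hφ).2 hT0) fun p hp k hk hpk => by
        refine pow_dvd_map_truncPart φ hk hP hp.prime (hpk.trans ?_)
        rw [← map_prod]
        exact map_dvd φ hSP
    rw [hφdeg, hφdeg] at h1
    have h2 := MvPolynomial.natDegree_lineHom_le a (truncPart (∑ j : Fin B.card, (j : ℕ)) P)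
    rw [truncRadDeg]
    omega

theorem mainTheorem2 (l n : ℕ) (hn : 3 ≤ n) (f : Fin n → MvPolynomial (Fin l) ℂ)
    (hnonconst : ¬ ∀ i, ∃ c : ℂ, f i = MvPolynomial.C c)
    (hsum : ∑ i, f i = 0)
    (hsub : ∀ S : Finset (Fin n), S.Nonempty → ∑ i ∈ S, f i = 0 → S.gcd f = 1)
    (d : ℕ) (hd : d = Module.finrank ℂ (Submodule.span ℂ (Set.range f))) :
    ∃ σ : ℕ, 1 ≤ σ ∧ (σ : ℚ) ≤ (d : ℚ) * ((d : ℚ) - 1) / 2 ∧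
      ((Finset.univ.sup fun i => (f i).totalDegree : ℕ) : ℚ) ≤
        (truncRadDeg σ (∏ i, f i) : ℚ) - (σ : ℚ) ∧
      ∀ d' : ℕ, d ≤ d' →
        (truncRadDeg σ (∏ i, f i) : ℚ) - (σ : ℚ) ≤
          (d' : ℚ) * ((d' : ℚ) - 1) / 2 * ((radDeg (∏ i, f i) : ℚ) - 1) := by
  have hgcd : ∀ S : Finset (Fin n), S.Nonempty → ∑ i ∈ S, f i = 0 →
      ∀ q, (∀ i ∈ S, q ∣ f i) → IsUnit q := fun S hS h0 q hq =>
    isUnit_of_dvd_one (hsub S hS h0 ▸ Finset.dvd_gcd hq)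
  -- A zero term would be a one-term vanishing subsum with gcd `0`.
  have hf : ∀ i, f i ≠ 0 := fun i hi =>
    not_isUnit_zero (hgcd {i} (by simp) (by simpa using hi) 0 (by simp [hi]))
  have hne : (Finset.univ : Finset (Fin n)).Nonempty := ⟨⟨0, by omega⟩, Finset.mem_univ _⟩
  obtain ⟨m, -, hm⟩ := Finset.exists_mem_eq_sup Finset.univ hne fun i => (f i).totalDegree
  have hmpos : 0 < (f m).totalDegree := by
    push Not at hnonconst
    obtain ⟨i, hi⟩ := hnonconst
    have h1 : (f i).totalDegree ≤ (f m).totalDegree :=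
      hm ▸ Finset.le_sup (f := fun i => (f i).totalDegree) (Finset.mem_univ i)
    refine lt_of_lt_of_le (Nat.pos_of_ne_zero fun h0 => ?_) h1
    exact hi _ (MvPolynomial.totalDegree_eq_zero_iff_eq_C.1 h0)
  obtain ⟨S, hS, hmS, hS0, hSmin⟩ := exists_minimal_zero_sum f (Finset.mem_univ m) hsum
  have hP : ∏ i, f i ≠ 0 := Finset.prod_ne_zero_iff.2 fun i _ => hf i
  obtain ⟨B, -, hB, hmain⟩ := exists_totalDegree_add_le hmS (fun i _ => hf i) hS0 hSmin
    (hgcd S ⟨m, hmS⟩ hS0) hP (Finset.prod_dvd_prod_of_subset _ _ f hS)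
  have hBd : B.card ≤ d := by
    have h1 : Module.finrank ℂ (Submodule.span ℂ (f '' B)) = B.card := by
      rw [Set.image_eq_range]
      simpa using finrank_span_eq_card hB
    have := Module.Finite.span_of_finite ℂ (Set.finite_range f)
    rw [hd, ← h1]
    exact Submodule.finrank_mono (Submodule.span_mono (Set.image_subset_range _ _))
  set s := ∑ j : Fin B.card, (j : ℕ) with hs
  have hs2 : (s : ℚ) * 2 = B.card * (B.card - 1) := by
    have h1 : s * 2 = B.card * (B.card - 1) := by
      rw [hs, Fin.sum_univ_eq_sum_range (fun i => i), Finset.sum_range_id_mul_two]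
    rcases Nat.eq_zero_or_pos B.card with h0 | h0
    · rw [h0] at h1 ⊢
      have : s = 0 := by omega
      simp [this]
    · have := congrArg (Nat.cast : ℕ → ℚ) h1
      push_cast [Nat.cast_sub h0] at this
      exact this
  have hle := truncRadDeg_le s (∏ i, f i)
  -- For `s = 0` the truncated degree is `0`, contradicting `deg f m > 0`.
  have hs1 : 1 ≤ s := by
    by_contra h
    have : s = 0 := by omega
    rw [this] at hle hmain
    omega
  have hr1 : 1 ≤ radDeg (∏ i, f i) := by
    by_contra h
    have : radDeg (∏ i, f i) = 0 := by omega
    rw [this] at hle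
    omega
  have hcard1 : 1 ≤ B.card := by
    by_contra h
    have h0 : B.card = 0 := by omega
    rw [h0] at hs2
    have : (s : ℚ) = 0 := by simpa using hs2
    have : s = 0 := by exact_mod_cast this
    omega
  have hsd : ∀ d' : ℕ, d ≤ d' → (s : ℚ) ≤ (d' : ℚ) * ((d' : ℚ) - 1) / 2 := by
    intro d' hd'
    have h1 : (B.card : ℚ) ≤ d' := by exact_mod_cast hBd.trans hd'
    have h2 : (1 : ℚ) ≤ B.card := by exact_mod_cast hcard1
    have h3 := mul_le_mul h1 (sub_le_sub_right h1 1) (by linarith) (by linarith)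
    linarith
  refine ⟨s, hs1, hsd d le_rfl, ?_, fun d' hd' => ?_⟩
  · rw [hm, le_sub_iff_add_le]
    exact_mod_cast hmain
  · have h1 : (truncRadDeg s (∏ i, f i) : ℚ) ≤ s * radDeg (∏ i, f i) := by exact_mod_cast hle
    have h2 : (1 : ℚ) ≤ radDeg (∏ i, f i) := by exact_mod_cast hr1
    calc (truncRadDeg s (∏ i, f i) : ℚ) - s ≤ s * (radDeg (∏ i, f i) - 1) := by linarith
      _ ≤ _ := mul_le_mul_of_nonneg_right (hsd d' hd') (by linarith)
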